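/- Let $\mathcal S,\mathcal A$ be finite sets of states and actions, and write $\Delta(X)$ for the probability simplex over a finite set $X$. Let $\mathcal P\subseteq\Delta(\mathcal S)^{\mathcal S\times\mathcal A}$ be a compact convex set of transition probabilities $P=(P_{sa})_{s,a}$ (the uncertainty set). A stationary policy is an element $\pi\in\Delta(\mathcal A)^{\mathcal S}$. Let $\mathcal P_{\mathsf H}$ be the set of history-dependent adversaries over $\mathcal P$, i.e. of families $Q$ that assign to every period $t\ge 0$ and every history $(s_0,a_0,\dots,s_{t-1},a_{t-1},s_t)$ an element of $\mathcal P$; every $P\in\mathcal P$ is identified with the constant adversary. For rewards $r\in\mathbb R^{\mathcal S\times\mathcal A\times\mathcal S}$, a discount factor $\gamma\in[0,1)$, a stationary policy $\pi$ and an adversary $Q\in\mathcal P_{\mathsf H}$, let $$v^{\pi,Q}_s=\mathbb E^{\pi,Q}\Big[\sum_{t=0}^{\infty}\gamma^t r_{s_ta_ts_{t+1}}\,\Big|\,s_0=s\Big],\qquad s\in\mathcal S,$$ where, given the history up to $s_t$, the action $a_t$ is drawn from $\pi_{s_t}$ and then $s_{t+1}$ from $P_{s_ta_t}$, with $P=Q_t(s_0,a_0,\dots,s_{t-1},a_{t-1},s_t)\in\mathcal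 P$. Say that the rewards are independent of the next state if $r_{sas'}=r_{sas''}$ for all $s,a,s',s''$. Say that $\mathcal P$ is weakly s-tractable if, for all stationary policies $\pi$, all rewards $r$ that are independent of the next state, all $\gamma\in[0,1)$ and all $\mu\in\Delta(\mathcal S)$, the minimum on the left exists and $$\min_{P\in\mathcal P}\mu^\top v^{\pi,P}=\mu^\top u^{\pi},$$ where $u^\pi\in\mathbb R^{\mathcal S}$ is the unique vector with $u^\pi_s=\min_{P\in\mathcal P}\sum_{a}\pi_{sa}P_{sa}^\top(r_{sa}+\gamma u^\pi)$ for all $s\in\mathcal S$. Theorem. Assume that the compact convex uncertainty set $\mathcal P$ is weakly s-tractable. Then, for all rewards $r$ that are independent of the next state, all $\gamma\in[0,1)$, all $\mu\in\Delta(\mathcal S)$ and all stationary policies $\pi$, $$\inf_{Q\in\mathcal P_{\mathsf H}}\mu^\top v^{\pi,Q}=\min_{P\in\mathcal P}\mu^\top v^{\pi,P},$$ and the minimum on the right is attained. -/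

import Mathlib

open MeasureTheory ProbabilityTheory Set

namespace RobustMDP

section Model

variable (S A : Type*) [Fintype S] [Fintype A]

/-- Transition probabilities `P = (P_{sa})`, each `P_{sa}` in the simplex `Δ(S)`.
An uncertainty set is a subset of this type. -/
abbrev Transitions : Type _ := S → A → stdSimplex ℝ S

/-- Stationary (randomized) policies: `Δ(A)^S`. -/
abbrev StationaryPolicy : Type _ := S → stdSimplex ℝ A

/-- Rewards `r_{sas'}`. -/
abbrev Rewards : Type _ := S → A → S → ℝ

/-- Rules choosing, at each period `t`, transition probabilities as a function of the history
`(s_0, a_0, …, s_{t-1}, a_{t-1}, s_t)`. -/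
abbrev HistoryTransitions : Type _ := (t : ℕ) → (Fin t → S × A) → S → Transitions S A

end Model

variable {S A : Type*} [Fintype S] [Fintype A]

/-- The coordinates of transition probabilities, as a vector of `ℝ^{S × A × S}`. -/
def Transitions.toFun (P : Transitions S A) : S → A → S → ℝ := fun s a s' => P s a s'

/-- Convexity of an uncertainty set, as a subset of `ℝ^{S × A × S}`. -/
def IsConvex (𝒰 : Set (Transitions S A)) : Prop :=
  Convex ℝ (Transitions.toFun '' 𝒰)

/-- The history-dependent transition probabilities: at every period and after every history, an
element of `𝒰` is chosen. -/
def historyDependent (𝒰 : Set (Transitions S A)) : Set (HistoryTransitions S A) :=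
  {Q | ∀ t h s, Q t h s ∈ 𝒰}

/-- The adversary that plays the same transition probabilities at every period. -/
def stationary (P : Transitions S A) : HistoryTransitions S A := fun _ _ _ => P

section Value

variable [MeasurableSpace S] [MeasurableSpace A]

/-- The law of the pair (state, action) when the state is `s` and the action is drawn
from `π_s`. -/
noncomputable def stateActionLaw (π : StationaryPolicy S A) (s : S) : Measure (S × A) :=
  ∑ a, ENNReal.ofReal (π s a) • Measure.dirac (s, a)

/-- The law of the pair (state, action) when the state `s` is drawn from `p` and then the action
from `π_s`. -/
noncomputable def nextLaw (π : StationaryPolicy S A) (p : stdSimplex ℝ S) : Measure (S × A) :=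
  ∑ s, ENNReal.ofReal (p s) • stateActionLaw π s

theorem sum_ofReal_stdSimplex {X : Type*} [Fintype X] (p : stdSimplex ℝ X) :
    ∑ x, ENNReal.ofReal (p x) = 1 := by
  have h := ENNReal.ofReal_sum_of_nonneg (s := Finset.univ) (f := fun x => p x)
    (fun x _ => p.2.1 x)
  have h1 : ∑ x, p x = 1 := p.2.2
  rw [← h, h1, ENNReal.ofReal_one]

instance isProbabilityMeasure_stateActionLaw (π : StationaryPolicy S A) (s : S) :
    IsProbabilityMeasure (stateActionLaw π s) :=
  ⟨by simp [stateActionLaw, sum_ofReal_stdSimplex]⟩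

instance isProbabilityMeasure_nextLaw (π : StationaryPolicy S A) (p : stdSimplex ℝ S) :
    IsProbabilityMeasure (nextLaw π p) :=
  ⟨by simp [nextLaw, sum_ofReal_stdSimplex]⟩

variable [MeasurableSingletonClass S] [MeasurableSingletonClass A]

/-- The conditional law of `(s_{t+1}, a_{t+1})` given `(s_0, a_0, …, s_t, a_t)`: the adversary
observes `(s_0, a_0, …, s_{t-1}, a_{t-1}, s_t)` and chooses transition probabilities `P`; then
`s_{t+1}` is drawn from `P_{s_t a_t}` and `a_{t+1}` from `π_{s_{t+1}}`. -/
noncomputable def stepKernel (π : StationaryPolicy S A) (Q : HistoryTransitions S A) (t : ℕ) :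
    Kernel ((i : Finset.Iic t) → S × A) (S × A) :=
  Kernel.ofFunOfCountable fun h =>
    let past : Fin t → S × A := fun i => h ⟨i, Finset.mem_Iic.2 i.isLt.le⟩
    let now : S × A := h ⟨t, Finset.mem_Iic.2 le_rfl⟩
    nextLaw π (Q t past now.1 now.1 now.2)

instance isMarkovKernel_stepKernel (π : StationaryPolicy S A) (Q : HistoryTransitions S A)
    (t : ℕ) : IsMarkovKernel (stepKernel π Q t) :=
  ⟨fun _ => isProbabilityMeasure_nextLaw π _⟩

/-- The law of the trajectory `(s_0, a_0), (s_1, a_1), …` started from `s_0 = s`. -/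
noncomputable def trajectoryLaw (π : StationaryPolicy S A) (Q : HistoryTransitions S A) (s : S) :
    Measure (ℕ → S × A) :=
  Kernel.trajMeasure (X := fun _ => S × A) (stateActionLaw π s) (stepKernel π Q)

/-- The discounted reward `∑ γ^t r_{s_t a_t s_{t+1}}` along a trajectory. -/
noncomputable def discountedReward (r : Rewards S A) (γ : ℝ) (ω : ℕ → S × A) : ℝ :=
  ∑' t, γ ^ t * r (ω t).1 (ω t).2 (ω (t + 1)).1

/-- The value function `v^{π,Q}_s`. -/
noncomputable def value (r : Rewards S A) (γ : ℝ) (π : StationaryPolicy S A)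
    (Q : HistoryTransitions S A) (s : S) : ℝ :=
  ∫ ω, discountedReward r γ ω ∂(trajectoryLaw π Q s)

/-- The return `μᵀ v^{π,Q}`. -/
noncomputable def expectedReturn (μ : stdSimplex ℝ S) (r : Rewards S A) (γ : ℝ)
    (π : StationaryPolicy S A) (Q : HistoryTransitions S A) : ℝ :=
  ∑ s, μ s * value r γ π Q s

end Value

/-- `∑_a π_{sa} P_{sa}ᵀ (r_{sa} + γ v)`. -/
noncomputable def backup (r : Rewards S A) (γ : ℝ) (π : StationaryPolicy S A)
    (P : Transitions S A) (v : S → ℝ) (s : S) : ℝ :=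
  ∑ a, π s a * ∑ s', P s a s' * (r s a s' + γ * v s')

/-- `u` satisfies `u_s = min_{P ∈ 𝒰} ∑_a π_{sa} P_{sa}ᵀ (r_{sa} + γ u)` for all `s`, the minima
being attained. -/
def IsRobustFixedPoint (𝒰 : Set (Transitions S A)) (r : Rewards S A) (γ : ℝ)
    (π : StationaryPolicy S A) (u : S → ℝ) : Prop :=
  ∀ s, IsLeast ((fun P => backup r γ π P u s) '' 𝒰) (u s)

theorem backup_sub_le (r : Rewards S A) {γ : ℝ} (hγ : 0 ≤ γ) (π : StationaryPolicy S A)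
    (P : Transitions S A) (v w : S → ℝ) (s : S) :
    backup r γ π P v s - backup r γ π P w s ≤ γ * dist v w := by
  have h1 : ∀ a, ∑ s', P s a s' * (r s a s' + γ * v s')
      ≤ ∑ s', P s a s' * (r s a s' + γ * w s') + γ * dist v w := by
    intro a
    have h2 : γ * dist v w = ∑ s', P s a s' * (γ * dist v w) := by
      rw [← Finset.sum_mul]
      have : ∑ s', P s a s' = 1 := (P s a).2.2
      rw [this, one_mul]
    rw [h2, ← Finset.sum_add_distrib]
    refine Finset.sum_le_sum fun s' _ => ?_
    rw [← mul_add]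
    refine mul_le_mul_of_nonneg_left ?_ ((P s a).2.1 s')
    have h3 : v s' - w s' ≤ dist v w :=
      (le_abs_self _).trans ((Real.dist_eq _ _).symm.le.trans (dist_le_pi_dist v w s'))
    nlinarith
  have h4 : backup r γ π P v s ≤ backup r γ π P w s + γ * dist v w := by
    have h5 : γ * dist v w = ∑ a, π s a * (γ * dist v w) := by
      rw [← Finset.sum_mul]
      have : ∑ a, π s a = 1 := (π s).2.2
      rw [this, one_mul]
    unfold backup
    rw [h5, ← Finset.sum_add_distrib]
    refine Finset.sum_le_sum fun a _ => ?_
    rw [← mul_add]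
    exact mul_le_mul_of_nonneg_left (h1 a) ((π s).2.1 a)
  linarith

/-- For a non-empty compact `𝒰`, the vector `u^π` exists and is unique. -/
theorem existsUnique_isRobustFixedPoint {𝒰 : Set (Transitions S A)} (hne : 𝒰.Nonempty)
    (hc : IsCompact 𝒰) (r : Rewards S A) {γ : ℝ} (h0 : 0 ≤ γ) (h1 : γ < 1)
    (π : StationaryPolicy S A) : ∃! u, IsRobustFixedPoint 𝒰 r γ π u := by
  have hmin : ∀ (v : S → ℝ) (s : S), ∃ m, IsLeast ((fun P => backup r γ π P v s) '' 𝒰) m := by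
    intro v s
    refine (hc.image ?_).exists_isLeast (hne.image _)
    unfold backup
    have hcoord : ∀ (a : A) (s' : S), Continuous fun P : Transitions S A => P s a s' := by
      intro a s'
      exact (continuous_apply s').comp (continuous_subtype_val.comp
        ((continuous_apply a).comp (continuous_apply s)))
    exact continuous_finsetSum _ fun a _ => continuous_const.mul
      (continuous_finsetSum _ fun s' _ => (hcoord a s').mul continuous_const)
  choose T hT using hmin
  have hle : ∀ v w s, T v s - T w s ≤ γ * dist v w := by
    intro v w s
    obtain ⟨P, hP, hPw⟩ := (hT w s).1
    have := (hT v s).2 ⟨P, hP, rfl⟩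
    have := backup_sub_le r h0 π P v w s
    simp only at *
    linarith
  have hcon : ContractingWith ⟨γ, h0⟩ T := by
    refine ⟨by exact_mod_cast h1, LipschitzWith.of_dist_le_mul fun v w => ?_⟩
    refine (dist_pi_le_iff (mul_nonneg h0 dist_nonneg)).2 fun s => ?_
    rw [Real.dist_eq, abs_le]
    have h2 := hle v w s
    have h3 := hle w v s
    rw [dist_comm w v] at h3
    constructor
    · change -(γ * dist v w) ≤ _
      linarith
    · exact h2
  have hiff : ∀ u, IsRobustFixedPoint 𝒰 r γ π u ↔ T u = u := by
    intro u
    constructor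
    · intro h
      funext s
      exact (hT u s).unique (h s)
    · intro h s
      have := hT u s
      rwa [h] at this
  refine ⟨hcon.fixedPoint, (hiff _).2 hcon.fixedPoint_isFixedPt, fun u hu => ?_⟩
  exact hcon.fixedPoint_unique ((hiff u).1 hu)

/-- The rewards do not depend on the next state. -/
def NextStateIndependent (r : Rewards S A) : Prop :=
  ∀ s a s' s'', r s a s' = r s a s''

/-- Weak s-tractability: `min_{P ∈ 𝒰} μᵀ v^{π,P} = μᵀ u^π` for all stationary `π`, all rewards
that do not depend on the next state, all `γ ∈ [0,1)` and all initial distributions `μ`. -/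
def WeaklySTractable [MeasurableSpace S] [MeasurableSpace A] [MeasurableSingletonClass S]
    [MeasurableSingletonClass A] (𝒰 : Set (Transitions S A)) : Prop :=
  ∀ (π : StationaryPolicy S A) (r : Rewards S A) (γ : ℝ) (μ : stdSimplex ℝ S),
    NextStateIndependent r → 0 ≤ γ → γ < 1 →
      ∃ u, IsRobustFixedPoint 𝒰 r γ π u ∧
        IsLeast ((fun P => expectedReturn μ r γ π (stationary P)) '' 𝒰) (∑ s, μ s * u s)

end RobustMDP

/-!
A constant adversary is history-dependent, so the infimum over history-dependent adversaries is at
most the minimum over `𝒰`, which weak s-tractability identifies with `μᵀ u` for the robust fixed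
point `u`. It remains to show that `u s` is a lower bound of `value r γ π Q s` for every
history-dependent adversary `Q` (`robustFixedPoint_le_value`).

Along a trajectory let `δ_t = r_{s_t a_t s_{t+1}} + γ u_{s_{t+1}} - u_{s_t}` (`bellmanError`). By
telescoping, the discounted reward equals `u_{s_0} + ∑ γ^t δ_t`, so it suffices that every `δ_t` has
non-negative expectation. Conditioning on the history up to and including the action `a_t` replaces
`δ_t` by `∑_{s'} P_{s_t a_t s'} (r_{s_t a_t s'} + γ u_{s'}) - u_{s_t}`, where `P ∈ 𝒰` is the choice
of the adversary, which may not depend on `a_t`. Averaging then over `a_t`, drawn from `π_{s_t}`,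
gives `backup r γ π P u s_t - u_{s_t}`, and this is non-negative because `u` is the minimum of the
backups over `𝒰`.
-/

namespace RobustMDP

variable {S A : Type*} [Fintype S] [Fintype A]

/-! ### The Bellman error along a trajectory -/

/-- The Bellman error `r_{xas'} + γ u_{s'} - u_x` of a transition from the state-action pair
`(x, a)` to the state `s'`. -/
def bellmanError (r : Rewards S A) (γ : ℝ) (u : S → ℝ) (x : S × A) (s' : S) : ℝ :=
  r x.1 x.2 s' + γ * u s' - u x.1

theorem sum_action_mul_sum_bellmanError (r : Rewards S A) (γ : ℝ) (u : S → ℝ)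
    (π : StationaryPolicy S A) (P : Transitions S A) (s : S) :
    ∑ a, π s a * ∑ s', P s a s' * bellmanError r γ u (s, a) s' = backup r γ π P u s - u s := by
  have h1 : ∀ a, ∑ s', P s a s' = 1 := fun a => (P s a).2.2
  have h2 : ∑ a, π s a = 1 := (π s).2.2
  simp only [bellmanError, backup, mul_sub, Finset.sum_sub_distrib, ← Finset.sum_mul, h1, h2,
    one_mul]

theorem hasSum_pow_mul_bellmanError (r : Rewards S A) {γ : ℝ} (h0 : 0 ≤ γ) (h1 : γ < 1)
    (u : S → ℝ) (ω : ℕ → S × A) :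
    HasSum (fun t => γ ^ t * bellmanError r γ u (ω t) (ω (t + 1)).1)
      (discountedReward r γ ω - u (ω 0).1) := by
  have hsum : ∀ f : S × A → S → ℝ, Summable fun t => γ ^ t * f (ω t) (ω (t + 1)).1 := by
    intro f
    obtain ⟨C, hC⟩ := (Set.finite_range (Function.uncurry f)).isBounded.exists_norm_le
    refine .of_norm_bounded ((summable_geometric_of_lt_one h0 h1).mul_right C) fun t => ?_
    rw [norm_mul, norm_pow, Real.norm_of_nonneg h0]
    exact mul_le_mul_of_nonneg_left (hC _ ⟨(_, _), rfl⟩) (pow_nonneg h0 t)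
  have hr := (hsum fun x s' => r x.1 x.2 s').hasSum
  have hu : Summable fun t => γ ^ t * u (ω t).1 := hsum fun x _ => u x.1
  -- The potential `γ ^ t * u (s_t)` telescopes.
  have hu' := ((hasSum_nat_add_iff' 1).2 hu.hasSum).sub hu.hasSum
  convert hr.add hu' using 1
  · funext t
    simp only [bellmanError]
    ring
  · simp only [discountedReward, Finset.sum_range_one]
    ring

variable [MeasurableSpace S] [MeasurableSpace A]
  [MeasurableSingletonClass S] [MeasurableSingletonClass A]

/-! ### Expectations under the one-step laws and the trajectory law -/

theorem integral_stateActionLaw (π : StationaryPolicy S A) (s : S) (f : S × A → ℝ) :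
    ∫ x, f x ∂stateActionLaw π s = ∑ a, π s a * f (s, a) := by
  unfold stateActionLaw
  rw [integral_finsetSum_measure fun a _ =>
    (Integrable.of_finite (μ := Measure.dirac (s, a))).smul_measure ENNReal.ofReal_ne_top]
  refine Finset.sum_congr rfl fun a _ => ?_
  rw [integral_smul_measure, integral_dirac, smul_eq_mul]
  exact congrArg (· * f (s, a)) (ENNReal.toReal_ofReal ((π s).2.1 a))

theorem integral_nextLaw (π : StationaryPolicy S A) (p : stdSimplex ℝ S) (f : S × A → ℝ) :
    ∫ x, f x ∂nextLaw π p = ∑ s, p s * ∑ a, π s a * f (s, a) := by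
  unfold nextLaw
  rw [integral_finsetSum_measure fun s _ =>
    (Integrable.of_finite (μ := stateActionLaw π s)).smul_measure ENNReal.ofReal_ne_top]
  refine Finset.sum_congr rfl fun s _ => ?_
  rw [integral_smul_measure, integral_stateActionLaw, smul_eq_mul]
  exact congrArg (· * _) (ENNReal.toReal_ofReal (p.2.1 s))

instance isProbabilityMeasure_trajectoryLaw (π : StationaryPolicy S A)
    (Q : HistoryTransitions S A) (s : S) : IsProbabilityMeasure (trajectoryLaw π Q s) := by
  unfold trajectoryLaw
  infer_instance

theorem map_zero_trajectoryLaw (π : StationaryPolicy S A) (Q : HistoryTransitions S A) (s : S) :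
    (trajectoryLaw π Q s).map (fun ω => ω 0) = stateActionLaw π s := by
  have h : (fun ω : ℕ → S × A => ω 0) =
      (MeasurableEquiv.piUnique fun _ : Finset.Iic 0 => S × A) ∘
        Preorder.frestrictLe (π := fun _ => S × A) 0 := rfl
  rw [h, ← Measure.map_map (by fun_prop) (by fun_prop), trajectoryLaw, Kernel.trajMeasure,
    Measure.map_comp _ _ (by fun_prop), Kernel.traj_map_frestrictLe, Kernel.partialTraj_self,
    Measure.id_comp]
  exact MeasurableEquiv.map_map_symm _

/-- Conditioning on the history up to the action at time `t`. -/
theorem integral_trajectoryLaw_succ (π : StationaryPolicy S A) (Q : HistoryTransitions S A) (s : S)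
    (t : ℕ) (f : ((i : Finset.Iic t) → S × A) → S × A → ℝ) :
    ∫ ω, f (Preorder.frestrictLe t ω) (ω (t + 1)) ∂trajectoryLaw π Q s =
      ∫ ω, ∑ s', Q t (fun i => ω i) (ω t).1 (ω t).1 (ω t).2 s' *
        ∑ a', π s' a' * f (Preorder.frestrictLe t ω) (s', a') ∂trajectoryLaw π Q s := by
  have hf : Measurable (Function.uncurry f) := measurable_of_finite _
  have hmap := Kernel.map_frestrictLe_trajMeasure_compProd_eq_map_trajMeasure
    (X := fun _ => S × A) (μ₀ := stateActionLaw π s) (κ := stepKernel π Q) (a := t)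
  change _ = (trajectoryLaw π Q s).map _ at hmap
  calc ∫ ω, f (Preorder.frestrictLe t ω) (ω (t + 1)) ∂trajectoryLaw π Q s
      = ∫ z, Function.uncurry f z ∂(trajectoryLaw π Q s).map
          (fun ω => (Preorder.frestrictLe t ω, ω (t + 1))) := by
        rw [integral_map (by fun_prop) hf.aestronglyMeasurable]
        rfl
    _ = ∫ h, ∫ x, f h x ∂stepKernel π Q t h
          ∂(trajectoryLaw π Q s).map (Preorder.frestrictLe t) := by
        rw [← hmap]
        exact Measure.integral_compProd Integrable.of_finite
    _ = ∫ ω, ∫ x, f (Preorder.frestrictLe t ω) x ∂stepKernel π Q t (Preorder.frestrictLe t ω)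
          ∂trajectoryLaw π Q s :=
        integral_map (by fun_prop) (measurable_of_finite _).aestronglyMeasurable
    _ = _ := integral_congr_ae (.of_forall fun ω => integral_nextLaw π _ _)

/-- Given the history up to the state at time `t`, the action is drawn from the policy: a function
of history and action whose average over the action is non-negative has non-negative expectation. -/
theorem integral_nonneg_of_forall_action_average_nonneg (π : StationaryPolicy S A)
    (Q : HistoryTransitions S A) (s : S) (t : ℕ) (F : (Fin t → S × A) → S × A → ℝ)
    (hF : ∀ h s, 0 ≤ ∑ a, π s a * F h (s, a)) :
    0 ≤ ∫ ω, F (fun i => ω i) (ω t) ∂trajectoryLaw π Q s := by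
  cases t with
  | zero =>
    have h : ∫ ω, F (fun i => ω i) (ω 0) ∂trajectoryLaw π Q s =
        ∫ x, F Fin.elim0 x ∂stateActionLaw π s := by
      rw [← map_zero_trajectoryLaw π Q s, integral_map (measurable_pi_apply 0).aemeasurable
        (measurable_of_finite _).aestronglyMeasurable]
      exact integral_congr_ae (.of_forall fun ω => congrArg (F · (ω 0)) (Subsingleton.elim _ _))
    rw [h, integral_stateActionLaw]
    exact hF _ s
  | succ t =>
    have h := integral_trajectoryLaw_succ π Q s t
      fun h x => F (fun i => h ⟨i, Finset.mem_Iic.2 (Nat.lt_succ_iff.1 i.isLt)⟩) x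
    refine le_of_le_of_eq (integral_nonneg fun ω => ?_) h.symm
    exact Finset.sum_nonneg fun s' _ => mul_nonneg ((Q t _ _ _ _).2.1 s') (hF _ s')

/-! ### The robust fixed point bounds the value from below -/

theorem integral_bellmanError_nonneg {𝒰 : Set (Transitions S A)} {r : Rewards S A} {γ : ℝ}
    {π : StationaryPolicy S A} {u : S → ℝ} (hu : IsRobustFixedPoint 𝒰 r γ π u)
    {Q : HistoryTransitions S A} (hQ : Q ∈ historyDependent 𝒰) (s : S) (t : ℕ) :
    0 ≤ ∫ ω, bellmanError r γ u (ω t) (ω (t + 1)).1 ∂trajectoryLaw π Q s := by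
  have h := integral_trajectoryLaw_succ π Q s t
    fun h x => bellmanError r γ u (h ⟨t, Finset.mem_Iic.2 le_rfl⟩) x.1
  have hπ : ∀ s, ∑ a, π s a = 1 := fun s => (π s).2.2
  simp only [← Finset.sum_mul, hπ, one_mul] at h
  refine le_of_le_of_eq ?_ h.symm
  refine integral_nonneg_of_forall_action_average_nonneg π Q s t
    (fun h x => ∑ s', Q t h x.1 x.1 x.2 s' * bellmanError r γ u x s') fun h s => ?_
  refine le_of_le_of_eq ?_ (sum_action_mul_sum_bellmanError r γ u π (Q t h s) s).symm
  exact sub_nonneg.2 ((hu s).2 ⟨_, hQ t h s, rfl⟩)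

theorem robustFixedPoint_le_value {𝒰 : Set (Transitions S A)} {r : Rewards S A} {γ : ℝ}
    (h0 : 0 ≤ γ) (h1 : γ < 1) {π : StationaryPolicy S A} {u : S → ℝ}
    (hu : IsRobustFixedPoint 𝒰 r γ π u) {Q : HistoryTransitions S A}
    (hQ : Q ∈ historyDependent 𝒰) (s : S) : u s ≤ value r γ π Q s := by
  obtain ⟨C, hC⟩ := (Set.finite_range
    (Function.uncurry (bellmanError r γ u))).isBounded.exists_norm_le
  have hbound : ∀ t (ω : ℕ → S × A),
      ‖γ ^ t * bellmanError r γ u (ω t) (ω (t + 1)).1‖ ≤ γ ^ t * C := by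
    intro t ω
    rw [norm_mul, norm_pow, Real.norm_of_nonneg h0]
    exact mul_le_mul_of_nonneg_left (hC _ ⟨(_, _), rfl⟩) (pow_nonneg h0 t)
  have hmeas : ∀ t, Measurable fun ω : ℕ → S × A =>
      γ ^ t * bellmanError r γ u (ω t) (ω (t + 1)).1 := fun t =>
    (measurable_of_finite fun z : (S × A) × (S × A) =>
      γ ^ t * bellmanError r γ u z.1 z.2.1).comp
        (g := fun z : (S × A) × (S × A) => γ ^ t * bellmanError r γ u z.1 z.2.1)
        (f := fun ω : ℕ → S × A => (ω t, ω (t + 1))) (by fun_prop)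
  have hsum : Summable fun t => γ ^ t * C := (summable_geometric_of_lt_one h0 h1).mul_right C
  have hhas := hasSum_integral_of_dominated_convergence (μ := trajectoryLaw π Q s)
    (fun t _ => γ ^ t * C) (fun t => (hmeas t).aestronglyMeasurable)
    (fun t => .of_forall (hbound t)) (.of_forall fun _ => hsum) (integrable_const _)
    (.of_forall (hasSum_pow_mul_bellmanError r h0 h1 u))
  have hnonneg : 0 ≤ ∫ ω, (discountedReward r γ ω - u (ω 0).1) ∂trajectoryLaw π Q s := by
    refine hhas.nonneg fun t => ?_
    rw [integral_const_mul]
    exact mul_nonneg (pow_nonneg h0 t) (integral_bellmanError_nonneg hu hQ s t)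
  have hu0 : Measurable fun x : S × A => u x.1 := measurable_of_finite _
  have hint0 : Integrable (fun ω : ℕ → S × A => u (ω 0).1) (trajectoryLaw π Q s) := by
    have h : Integrable (fun x : S × A => u x.1)
        ((trajectoryLaw π Q s).map fun ω => ω 0) := by
      rw [map_zero_trajectoryLaw]
      exact Integrable.of_finite
    exact h.comp_measurable (by fun_prop)
  have hint : Integrable (fun ω => discountedReward r γ ω - u (ω 0).1) (trajectoryLaw π Q s) := by
    have hlim : ∀ ω, ∑' t, γ ^ t * bellmanError r γ u (ω t) (ω (t + 1)).1 =
        discountedReward r γ ω - u (ω 0).1 := fun ω =>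
      (hasSum_pow_mul_bellmanError r h0 h1 u ω).tsum_eq
    refine .of_bound (C := ∑' t, γ ^ t * C) ?_ (.of_forall fun ω => ?_)
    · exact (measurable_of_tendsto_metrizable
        (fun n => Finset.measurable_sum (Finset.range n) fun t _ => hmeas t)
        (tendsto_pi_nhds.2 fun ω => by
          simpa only [Finset.sum_apply] using
            (hasSum_pow_mul_bellmanError r h0 h1 u ω).tendsto_sum_nat)).aestronglyMeasurable
    · rw [← hlim]
      exact tsum_of_norm_bounded hsum.hasSum fun t => hbound t ω
  have hinit : ∫ ω, u (ω 0).1 ∂trajectoryLaw π Q s = u s := by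
    have h := integral_map (μ := trajectoryLaw π Q s) (φ := fun ω => ω 0)
      (measurable_pi_apply 0).aemeasurable hu0.aestronglyMeasurable
    have hπ : ∑ a, π s a = 1 := (π s).2.2
    rw [← h, map_zero_trajectoryLaw, integral_stateActionLaw]
    dsimp only
    rw [← Finset.sum_mul, hπ, one_mul]
  have hvalue : value r γ π Q s =
      ∫ ω, (discountedReward r γ ω - u (ω 0).1) ∂trajectoryLaw π Q s + u s := by
    rw [value, ← hinit, ← integral_add hint hint0]
    simp only [sub_add_cancel]
  linarith

end RobustMDP

theorem mainTheorem9 {S A : Type*} [Fintype S] [Fintype A]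
    [MeasurableSpace S] [MeasurableSingletonClass S]
    [MeasurableSpace A] [MeasurableSingletonClass A]
    (𝒰 : Set (RobustMDP.Transitions S A))
    (hcompact : IsCompact 𝒰) (hconvex : RobustMDP.IsConvex 𝒰)
    (htract : RobustMDP.WeaklySTractable 𝒰)
    (r : RobustMDP.Rewards S A) (hr : RobustMDP.NextStateIndependent r)
    (γ : ℝ) (hγ0 : 0 ≤ γ) (hγ1 : γ < 1) (μ : stdSimplex ℝ S)
    (π : RobustMDP.StationaryPolicy S A) :
    ∃ m : ℝ,
      IsLeast ((fun P => RobustMDP.expectedReturn μ r γ π (RobustMDP.stationary P)) '' 𝒰) m ∧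
      IsGLB ((fun Q => RobustMDP.expectedReturn μ r γ π Q) '' RobustMDP.historyDependent 𝒰) m := by
  obtain ⟨u, hu, hleast⟩ := htract π r γ μ hr hγ0 hγ1
  refine ⟨_, hleast, IsLeast.isGLB ⟨?_, ?_⟩⟩
  · obtain ⟨P, hP, hPm⟩ := hleast.1
    exact ⟨RobustMDP.stationary P, fun _ _ _ => hP, hPm⟩
  · rintro _ ⟨Q, hQ, rfl⟩
    exact Finset.sum_le_sum fun s _ => mul_le_mul_of_nonneg_left
      (RobustMDP.robustFixedPoint_le_value hγ0 hγ1 hu hQ s) (μ.2.1 s)
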